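/- Let $K$ be an algebraically closed field of characteristic $0$ and let $f, g \in K[x_1,\dots,x_n]$ be polynomials that are coprime (every common divisor of $f$ and $g$ is a constant) and algebraically independent over $K$. If at least one of $f, g$ is irreducible, then the rational function $\varphi = f/g$ is closed, that is, $\varphi \in K(x_1,\dots,x_n) \setminus K$ and the subfield $K(\varphi)$ is algebraically closed in $K(x_1,\dots,x_n)$: every element of $K(x_1,\dots,x_n)$ that is algebraic over $K(\varphi)$ belongs to $K(\varphi)$. -/

import Mathlib

/-- The field `K(x₁, …, xₙ)` of rational functions in `n` variables over `K`. -/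
abbrev MvRatFunc (n : ℕ) (K : Type*) [Field K] : Type _ :=
  FractionRing (MvPolynomial (Fin n) K)

/-- A rational function `φ ∈ K(x₁, …, xₙ) \ K` is closed if the subfield `K(φ)` is algebraically
closed in `K(x₁, …, xₙ)`: every rational function that is algebraic over `K(φ)` lies in `K(φ)`. -/
def IsClosedRational {n : ℕ} {K : Type*} [Field K] (φ : MvRatFunc n K) : Prop :=
  φ ∉ Set.range (algebraMap K (MvRatFunc n K)) ∧
    ∀ ψ : MvRatFunc n K, IsAlgebraic (IntermediateField.adjoin K {φ}) ψ →
      ψ ∈ IntermediateField.adjoin K {φ}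

/-! Let `ψ` be algebraic over `K(φ)`. Restriction to a line on which `φ` stays nonconstant embeds
`K(φ, ψ)` into `K(t)`, so Lüroth's theorem gives `K(φ, ψ) = K(w)`
(`MvRatFunc.exists_mem_adjoin_simple`). Write `φ = P(w)/Q(w)` and `w = p/q`, both reduced, and let
`d` be the larger of the degrees of `P` and `Q`. Homogenizing and splitting over `K`, `f` and `g`
are, up to constants, products of `d` factors of the form `p - a q` or `q`.

If `d ≥ 2`, irreducibility of `f` or `g` makes one factor constant. Then `p` and `q`, hence `f` and
`g`, lie in a single `K[z]`, against algebraic independence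
(`MvPolynomial.natDegree_le_one_of_div_eq`). So `d ≤ 1`, `w` is a Möbius transform of `φ`, and `ψ ∈
K(w) ⊆ K(φ)`. -/

/-! ### Algebraic elements and injectivity -/

open IntermediateField in
/-- A nonzero element algebraic over `K(x)` divides a nonzero polynomial in `x`. -/
theorem IsAlgebraic.exists_aeval_eq_mul {K F : Type*} [Field K] [Field F] [Algebra K F] {x z : F}
    (hz : IsAlgebraic K⟮x⟯ z) (hz0 : z ≠ 0) :
    ∃ p : Polynomial K, Polynomial.aeval x p ≠ 0 ∧
      ∃ y ∈ Algebra.adjoin K {x, z}, Polynomial.aeval x p = z * y := by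
  open scoped algebraAdjoinAdjoin in
  have hz' : IsAlgebraic (Algebra.adjoin K {x}) z :=
    (IsFractionRing.isAlgebraic_iff (Algebra.adjoin K {x}) K⟮x⟯ F).2 hz
  -- The relation `q(z) = 0` reads `q₀ = -z * (q.divX)(z)`, and the nonzero `q₀` is a polynomial in
  -- `x`.
  obtain ⟨q, hq0, hq⟩ := hz'.exists_nonzero_coeff_and_aeval_eq_zero
    (mem_nonZeroDivisors_of_ne_zero hz0)
  obtain ⟨p, hp⟩ : ∃ p : Polynomial K, Polynomial.aeval x p = (q.coeff 0 : F) := by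
    rw [← AlgHom.mem_range, ← Algebra.adjoin_singleton_eq_range_aeval]
    exact (q.coeff 0).2
  refine ⟨p, ?_, -Polynomial.aeval z q.divX, ?_, ?_⟩
  · rw [hp]
    exact_mod_cast hq0
  · refine neg_mem ?_
    rw [Polynomial.aeval_eq_sum_range]
    refine sum_mem fun i _ => ?_
    rw [Algebra.smul_def]
    refine mul_mem (Algebra.adjoin_mono (by simp) (q.divX.coeff i).2) (pow_mem ?_ _)
    exact Algebra.subset_adjoin (by simp)
  · have h := q.divX_mul_X_add
    apply_fun Polynomial.aeval z at h
    rw [hq] at h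
    simp only [map_add, map_mul, Polynomial.aeval_X, Polynomial.aeval_C] at h
    rw [hp]
    have : (algebraMap (Algebra.adjoin K {x}) F) (q.coeff 0) = (q.coeff 0 : F) := rfl
    rw [this] at h
    linear_combination h

open IntermediateField in
/-- A `K`-algebra homomorphism from `K[x, y]`, with `y` algebraic over `K(x)`, that sends `x` to a
transcendental element is injective. -/
theorem AlgHom.injective_of_transcendental {K F L : Type*} [Field K] [Field F] [Algebra K F]
    [Field L] [Algebra K L] {x y : F} (hy : IsAlgebraic K⟮x⟯ y)
    (θ : Algebra.adjoin K {x, y} →ₐ[K] L)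
    (hθ : Transcendental K (θ ⟨x, Algebra.subset_adjoin (by simp)⟩)) :
    Function.Injective θ := by
  set x' : Algebra.adjoin K {x, y} := ⟨x, Algebra.subset_adjoin (by simp)⟩
  rw [injective_iff_map_eq_zero]
  intro z hz
  by_contra hz0
  have hle : Algebra.adjoin K {x, y} ≤ (algebraicClosure K⟮x⟯ F).toSubalgebra.restrictScalars K := by
    rw [Algebra.adjoin_le_iff]
    rintro a (rfl | rfl)
    · exact mem_algebraicClosure_iff.2
        (isAlgebraic_algebraMap (A := F) (AdjoinSimple.gen K a : K⟮a⟯))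
    · exact mem_algebraicClosure_iff.2 hy
  have hzalg : IsAlgebraic K⟮x⟯ (z : F) := mem_algebraicClosure_iff.1 (hle z.2)
  -- A nonzero kernel element divides some `p(x) ≠ 0`, so `θ` would kill `p(x)` and `θ x` would be
  -- algebraic.
  obtain ⟨p, hp0, w, hw, hpw⟩ := hzalg.exists_aeval_eq_mul (by simpa using hz0)
  have hw' : w ∈ Algebra.adjoin K {x, y} := by
    refine Algebra.adjoin_le ?_ hw
    rintro a (rfl | rfl)
    · exact Algebra.subset_adjoin (by simp)
    · exact z.2
  have hxz : Polynomial.aeval x' p = z * ⟨w, hw'⟩ := by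
    apply Subtype.val_injective
    rw [← Subalgebra.coe_val, ← Polynomial.aeval_algHom_apply]
    exact hpw
  have h0 : Polynomial.aeval (θ x') p = 0 := by
    rw [Polynomial.aeval_algHom_apply, hxz, map_mul, hz, zero_mul]
  have : p = 0 := by
    by_contra hp
    exact hθ ⟨p, hp, h0⟩
  simp [this] at hp0

/-! ### Restriction to a line and Lüroth's theorem -/

open IntermediateField in
/-- Over an infinite field, the field `K(φ, ψ)` generated by a nonconstant rational function `φ`
and a rational function `ψ` algebraic over `K(φ)` embeds into `K(t)`. -/
theorem MvRatFunc.exists_algHom_ratFunc {n : ℕ} {K : Type*} [Field K] [Infinite K]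
    {φ ψ : MvRatFunc n K} (hφ : φ ∉ Set.range (algebraMap K (MvRatFunc n K)))
    (hψ : IsAlgebraic K⟮φ⟯ ψ) :
    Nonempty (K⟮φ, ψ⟯ →ₐ[K] RatFunc K) := by
  classical
  obtain ⟨f, g, hg, rfl⟩ := IsFractionRing.div_surjective (A := MvPolynomial (Fin n) K) φ
  obtain ⟨a, b, hb, rfl⟩ := IsFractionRing.div_surjective (A := MvPolynomial (Fin n) K) ψ
  have hg0 := nonZeroDivisors.ne_zero hg
  have hb0 := nonZeroDivisors.ne_zero hb
  have exists_pt : ∀ h : MvPolynomial (Fin n) K, h ≠ 0 → ∃ u, MvPolynomial.eval u h ≠ 0 := by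
    intro h hh
    by_contra! H
    exact hh (MvPolynomial.funext fun u => by simpa using H u)
  obtain ⟨u, hu⟩ := exists_pt g hg0
  -- For `g(v) ≠ 0`, the condition `h(v) ≠ 0` says `φ(v) ≠ φ(u)`.
  set h : MvPolynomial (Fin n) K :=
    f * MvPolynomial.C (MvPolynomial.eval u g) - g * MvPolynomial.C (MvPolynomial.eval u f) with hh
  have hh0 : h ≠ 0 := by
    intro h0
    refine hφ ⟨MvPolynomial.eval u f / MvPolynomial.eval u g, ?_⟩
    have hgF : algebraMap _ (MvRatFunc n K) g ≠ 0 := by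
      simpa using hg0
    have hcF : algebraMap K (MvRatFunc n K) (MvPolynomial.eval u g) ≠ 0 := by
      simpa using hu
    rw [map_div₀, div_eq_div_iff hcF hgF]
    have := congrArg (algebraMap _ (MvRatFunc n K)) (sub_eq_zero.1 (hh.symm.trans h0))
    simp only [map_mul, ← MvPolynomial.algebraMap_eq,
      ← IsScalarTower.algebraMap_apply] at this
    rw [this, mul_comm]
  obtain ⟨v, hv⟩ := exists_pt (g * b * h) (mul_ne_zero (mul_ne_zero hg0 hb0) hh0)
  simp only [map_mul, mul_ne_zero_iff] at hv
  obtain ⟨⟨hvg, hvb⟩, hvh⟩ := hv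
  -- restriction to the line through `u` and `v`
  let ev : MvPolynomial (Fin n) K →ₐ[K] Polynomial K :=
    MvPolynomial.aeval fun i => Polynomial.C (u i) + Polynomial.X * Polynomial.C (v i - u i)
  have ev0 : ∀ p, (ev p).eval 0 = MvPolynomial.eval u p := by
    intro p
    have : (Polynomial.aeval (0 : K)).comp ev = MvPolynomial.aeval u := by
      ext i; simp [ev]
    simpa [Polynomial.coe_aeval_eq_eval] using DFunLike.congr_fun this p
  have ev1 : ∀ p, (ev p).eval 1 = MvPolynomial.eval v p := by
    intro p
    have : (Polynomial.aeval (1 : K)).comp ev = MvPolynomial.aeval v := by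
      ext i; simp [ev]
    simpa [Polynomial.coe_aeval_eq_eval] using DFunLike.congr_fun this p
  let ρ : MvPolynomial (Fin n) K →ₐ[K] RatFunc K :=
    (IsScalarTower.toAlgHom K (Polynomial K) (RatFunc K)).comp ev
  have hρ : ∀ p, ρ p = algebraMap (Polynomial K) (RatFunc K) (ev p) := fun _ => rfl
  have hρ0 : ∀ p, MvPolynomial.eval v p ≠ 0 → ρ p ≠ 0 := by
    intro p hp h0
    rw [hρ, map_eq_zero_iff _ (RatFunc.algebraMap_injective K)] at h0
    exact hp (by rw [← ev1, h0, Polynomial.eval_zero])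
  -- Inverting the polynomials not vanishing identically on the line gives a ring `B` that contains
  -- `φ` and `ψ` and to which restriction extends.
  let M : Submonoid (MvPolynomial (Fin n) K) := (nonZeroDivisors (RatFunc K)).comap ρ
  have hM : M ≤ nonZeroDivisors (MvPolynomial (Fin n) K) := by
    intro p hp
    refine mem_nonZeroDivisors_of_ne_zero ?_
    rintro rfl
    exact nonZeroDivisors.ne_zero (Submonoid.mem_comap.1 hp) (map_zero ρ)
  let B := Localization.subalgebra.ofField (MvRatFunc n K) M hM
  have hBmem : ∀ p q : MvPolynomial (Fin n) K, ρ q ≠ 0 →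
      algebraMap _ (MvRatFunc n K) p / algebraMap _ _ q ∈ B := by
    intro p q hq
    exact ⟨p, q, mem_nonZeroDivisors_of_ne_zero hq, div_eq_mul_inv _ _⟩
  let Θ : B →ₐ[K] RatFunc K := IsLocalization.liftAlgHom (M := M) (f := ρ)
    fun y => (nonZeroDivisors.ne_zero y.2).isUnit
  have hΘ : ∀ p, Θ (algebraMap _ B p) = ρ p := fun p => IsLocalization.lift_eq (M := M) _ _
  set φ := algebraMap _ (MvRatFunc n K) f / algebraMap _ _ g
  set ψ := algebraMap _ (MvRatFunc n K) a / algebraMap _ _ b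
  have hle : Algebra.adjoin K {φ, ψ} ≤ B.restrictScalars K := by
    rw [Algebra.adjoin_le_iff]
    rintro _ (rfl | rfl)
    · exact hBmem _ _ (hρ0 _ hvg)
    · exact hBmem _ _ (hρ0 _ hvb)
  let θ : Algebra.adjoin K {φ, ψ} →ₐ[K] RatFunc K :=
    AlgHom.comp (B := B) Θ (Subalgebra.inclusion hle)
  have hinj : Function.Injective θ := by
    refine AlgHom.injective_of_transcendental hψ θ ?_
    set φ' : Algebra.adjoin K {φ, ψ} := ⟨φ, Algebra.subset_adjoin (by simp)⟩
    have hmul : θ φ' * ρ g = ρ f := by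
      change Θ (⟨φ, hle φ'.2⟩ : B) * _ = _
      rw [← hΘ, ← hΘ, ← map_mul]
      congr 1
      apply Subtype.val_injective
      change φ * algebraMap _ (MvRatFunc n K) g = algebraMap _ (MvRatFunc n K) f
      exact div_mul_cancel₀ _ (by simpa using hg0)
    refine RatFunc.transcendental_of_ne_C _ ?_
    -- A constant restriction `c` gives `f = c g` at both `u` and `v`, forcing `h(v) = 0`.
    rintro ⟨c, hc⟩
    rw [hc, hρ, hρ, ← RatFunc.algebraMap_C, ← map_mul] at hmul
    have hpoly := RatFunc.algebraMap_injective K hmul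
    have h0 := congrArg (Polynomial.eval 0) hpoly
    have h1 := congrArg (Polynomial.eval 1) hpoly
    simp only [Polynomial.eval_mul, Polynomial.eval_C, ev0, ev1] at h0 h1
    apply hvh
    simp only [hh, map_sub, map_mul, MvPolynomial.eval_C]
    rw [← h0, ← h1]
    ring
  open scoped algebraAdjoinAdjoin in
  exact ⟨IsFractionRing.liftAlgHom (K := K⟮φ, ψ⟯) hinj⟩

open IntermediateField in
/-- A finitely generated field of transcendence degree one in `K(x₁, …, xₙ)` lies in a simple
extension of `K`. -/
theorem MvRatFunc.exists_mem_adjoin_simple {n : ℕ} {K : Type*} [Field K] [Infinite K]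
    {φ ψ : MvRatFunc n K} (hφ : φ ∉ Set.range (algebraMap K (MvRatFunc n K)))
    (hψ : IsAlgebraic K⟮φ⟯ ψ) :
    ∃ w : MvRatFunc n K, φ ∈ K⟮w⟯ ∧ ψ ∈ K⟮w⟯ := by
  obtain ⟨θ⟩ := exists_algHom_ratFunc hφ hψ
  obtain ⟨w, hw⟩ : RatFunc.Luroth.generator θ.fieldRange ∈ θ.fieldRange :=
    RatFunc.Luroth.generator_mem
  have hw : θ w = _ := hw
  have key : ∀ z : K⟮φ, ψ⟯, (z : MvRatFunc n K) ∈ K⟮(w : MvRatFunc n K)⟯ := by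
    intro z
    have hz : θ z ∈ K⟮θ w⟯ := by
      rw [hw, ← RatFunc.Luroth.eq_adjoin_generator]
      exact ⟨z, rfl⟩
    rw [mem_adjoin_simple_iff] at hz ⊢
    obtain ⟨r, s, hrs⟩ := hz
    refine ⟨r, s, ?_⟩
    rw [Polynomial.aeval_algHom_apply, Polynomial.aeval_algHom_apply, ← map_div₀] at hrs
    have := congrArg (K⟮φ, ψ⟯).val (θ.injective hrs)
    rw [map_div₀, ← Polynomial.aeval_algHom_apply, ← Polynomial.aeval_algHom_apply] at this
    exact this
  exact ⟨w, key ⟨φ, subset_adjoin _ _ (by simp)⟩, key ⟨ψ, subset_adjoin _ _ (by simp)⟩⟩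

/-! ### Coprimality and irreducibility of products -/

theorem Multiset.isRelPrime_prod {M : Type*} [CommMonoid M] [DecompositionMonoid M]
    {s t : Multiset M} (h : ∀ x ∈ s, ∀ y ∈ t, IsRelPrime x y) : IsRelPrime s.prod t.prod := by
  induction s using Multiset.induction_on with
  | empty => simpa using isRelPrime_one_left
  | cons a s ih =>
    rw [Multiset.prod_cons]
    refine IsRelPrime.mul_left ?_ (ih fun x hx => h x (Multiset.mem_cons_of_mem hx))
    have ha := h a (Multiset.mem_cons_self a s)
    clear ih h
    induction t using Multiset.induction_on with
    | empty => simpa using isRelPrime_one_right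
    | cons b t ih =>
      rw [Multiset.prod_cons]
      exact (ha b (Multiset.mem_cons_self b t)).mul_right
        (ih fun y hy => ha y (Multiset.mem_cons_of_mem hy))

theorem Multiset.exists_isUnit_of_irreducible_prod {M : Type*} [CommMonoid M] {s : Multiset M}
    (hs : Irreducible s.prod) (hcard : 2 ≤ s.card) : ∃ x ∈ s, IsUnit x := by
  obtain ⟨x, hx⟩ := Multiset.card_pos_iff_exists_mem.1 (by lia : 0 < s.card)
  obtain ⟨t, rfl⟩ := Multiset.exists_cons_of_mem hx
  rw [Multiset.card_cons] at hcard
  obtain ⟨y, hy⟩ := Multiset.card_pos_iff_exists_mem.1 (by lia : 0 < t.card)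
  rw [Multiset.prod_cons] at hs
  rcases hs.isUnit_or_isUnit rfl with h | h
  · exact ⟨x, hx, h⟩
  · exact ⟨y, Multiset.mem_cons_of_mem hy, isUnit_of_dvd_unit (Multiset.dvd_prod hy) h⟩

/-- Two reduced fractions `f / g` and `a / b` that are equal have associated numerators and
associated denominators. -/
theorem IsRelPrime.associated_of_mul_eq_mul {M : Type*} [CommMonoidWithZero M] [IsCancelMulZero M]
    [DecompositionMonoid M]
    {f g a b : M} (hfg : IsRelPrime f g) (hab : IsRelPrime a b) (h : f * b = g * a) :
    Associated f a ∧ Associated g b := by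
  refine ⟨associated_of_dvd_dvd ?_ ?_, associated_of_dvd_dvd ?_ ?_⟩
  · exact hfg.dvd_of_dvd_mul_left ⟨b, h.symm⟩
  · exact hab.dvd_of_dvd_mul_right ⟨g, by rw [h, mul_comm]⟩
  · exact hfg.symm.dvd_of_dvd_mul_left ⟨a, h⟩
  · exact hab.symm.dvd_of_dvd_mul_right ⟨f, by rw [← h, mul_comm]⟩

/-! ### Homogenization and its linear factors -/

namespace Polynomial

/-- The linear factors of the degree `d` homogenization `q ^ d * P (p / q)` of a polynomial `P`. -/
noncomputable def homogFactors {K R : Type*} [Field K] [CommRing R] [Algebra K R] (P : K[X])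
    (d : ℕ) (p q : R) : Multiset R :=
  P.roots.map (fun a => p - algebraMap K R a * q) + Multiset.replicate (d - P.natDegree) q

variable {K R : Type*} [Field K] [CommRing R] [Algebra K R]

theorem mem_homogFactors {P : K[X]} {d : ℕ} {p q x : R} :
    x ∈ P.homogFactors d p q ↔ (∃ a ∈ P.roots, p - algebraMap K R a * q = x) ∨
      (d - P.natDegree ≠ 0 ∧ x = q) := by
  simp [homogFactors, Multiset.mem_replicate]

theorem card_homogFactors [IsAlgClosed K] {P : K[X]} {d : ℕ} (hd : P.natDegree ≤ d) (p q : R) :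
    (P.homogFactors d p q).card = d := by
  have := (IsAlgClosed.splits P).natDegree_eq_card_roots
  simp [homogFactors]
  lia

theorem algebraMap_homogFactors_prod [IsAlgClosed K] {F : Type*} [Field F] [Algebra R F]
    [Algebra K F] [IsScalarTower K R F] {P : K[X]} {d : ℕ} (hd : P.natDegree ≤ d) (p : R) {q : R}
    (hq : algebraMap R F q ≠ 0) :
    algebraMap K F P.leadingCoeff * algebraMap R F (P.homogFactors d p q).prod =
      algebraMap R F q ^ d * aeval (algebraMap R F p / algebraMap R F q) P := by
  have hsplit := IsAlgClosed.splits P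
  have hcard := hsplit.natDegree_eq_card_roots
  conv_rhs => rw [hsplit.eq_prod_roots]
  rw [homogFactors, Multiset.prod_add, Multiset.prod_replicate, map_mul, map_pow, map_mul, aeval_C,
    map_multiset_prod, map_multiset_prod, Multiset.map_map, Multiset.map_map]
  have h1 : (P.roots.map (algebraMap R F ∘ fun a => p - algebraMap K R a * q)).prod =
      algebraMap R F q ^ P.natDegree * (P.roots.map ((aeval (algebraMap R F p / algebraMap R F q)) ∘
        fun a => X - C a)).prod := by
    rw [hcard, ← Multiset.prod_replicate, ← Multiset.map_const', ← Multiset.prod_map_mul]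
    refine congrArg _ (Multiset.map_congr rfl fun a _ => ?_)
    simp only [Function.comp_apply, map_sub, map_mul, aeval_X, aeval_C,
      ← IsScalarTower.algebraMap_apply]
    field_simp
  rw [h1, show d = P.natDegree + (d - P.natDegree) by lia, pow_add]
  simp only [Nat.add_sub_cancel_left]
  ring

/-- Coprime `P` and `Q` share no root, and a common divisor of `p - a q` and `p - b q` with `a ≠ b`
divides `q`, hence also `p`. -/
theorem isRelPrime_homogFactors_prod [DecompositionMonoid R] {P Q : K[X]} (hPQ : IsCoprime P Q)
    {p q : R} (hpq : IsRelPrime p q) :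
    IsRelPrime (P.homogFactors (max P.natDegree Q.natDegree) p q).prod
      (Q.homogFactors (max P.natDegree Q.natDegree) p q).prod := by
  have hq : ∀ a : K, IsRelPrime (p - algebraMap K R a * q) q := by
    intro a
    rw [sub_eq_add_neg, ← neg_mul]
    exact IsRelPrime.add_mul_right_left_iff.2 hpq
  refine Multiset.isRelPrime_prod fun x hx y hy => ?_
  rcases mem_homogFactors.1 hx with ⟨a, ha, rfl⟩ | ⟨hd, rfl⟩ <;>
    rcases mem_homogFactors.1 hy with ⟨b, hb, rfl⟩ | ⟨hd', rfl⟩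
  · have hab : a ≠ b := by
      rintro rfl
      obtain ⟨u, v, huv⟩ := hPQ
      have := congrArg (eval a) huv
      simp [(isRoot_of_mem_roots ha).eq_zero, (isRoot_of_mem_roots hb).eq_zero] at this
    intro c hca hcb
    refine hq a hca ?_
    have h := dvd_sub hcb hca
    have : q = algebraMap K R (a - b)⁻¹ *
        (p - algebraMap K R b * q - (p - algebraMap K R a * q)) := by
      have h1 : algebraMap K R (a - b)⁻¹ * algebraMap K R (a - b) = 1 := by
        rw [← map_mul, inv_mul_cancel₀ (sub_ne_zero.2 hab), map_one]
      rw [map_sub] at h1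
      linear_combination -q * h1
    rw [this]
    exact h.mul_left _
  · exact hq a
  · exact (hq b).symm
  -- The factor `q` cannot occur on both sides: the maximum equals one of the two degrees.
  · lia

/-- If some linear factor of a homogenization in `p, q` is constant, then `p` and `q` are both
polynomials in a single element. -/
theorem exists_mem_adjoin_of_mem_homogFactors {P : K[X]} {d : ℕ} {p q : R} {c : K}
    (h : algebraMap K R c ∈ P.homogFactors d p q) :
    ∃ z : R, p ∈ Algebra.adjoin K {z} ∧ q ∈ Algebra.adjoin K {z} := by
  rcases mem_homogFactors.1 h with ⟨a, -, ha⟩ | ⟨-, hq⟩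
  · refine ⟨q, ?_, Algebra.self_mem_adjoin_singleton K q⟩
    rw [eq_add_of_sub_eq ha]
    exact add_mem (Subalgebra.algebraMap_mem _ c) (mul_mem (Subalgebra.algebraMap_mem _ a)
      (Algebra.self_mem_adjoin_singleton K q))
  · exact ⟨p, Algebra.self_mem_adjoin_singleton K p, hq ▸ Subalgebra.algebraMap_mem _ c⟩

theorem homogFactors_prod_mem {P : K[X]} {d : ℕ} {p q : R} {S : Subalgebra K R} (hp : p ∈ S)
    (hq : q ∈ S) : (P.homogFactors d p q).prod ∈ S := by
  refine multiset_prod_mem _ fun x hx => ?_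
  rcases mem_homogFactors.1 hx with ⟨a, -, rfl⟩ | ⟨-, rfl⟩
  · exact sub_mem hp (mul_mem (Subalgebra.algebraMap_mem _ a) hq)
  · exact hq

end Polynomial

/-- Independence would lift to two polynomials in `K[X]`, which has transcendence degree one. -/
theorem not_algebraicIndependent_of_mem_adjoin_singleton {K R : Type*} [Field K] [CommRing R]
    [Algebra K R] {f g z : R} (hf : f ∈ Algebra.adjoin K {z}) (hg : g ∈ Algebra.adjoin K {z}) :
    ¬ AlgebraicIndependent K ![f, g] := by
  rw [Algebra.adjoin_singleton_eq_range_aeval] at hf hg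
  obtain ⟨F, rfl⟩ := hf
  obtain ⟨G, rfl⟩ := hg
  intro h
  have h' : AlgebraicIndependent K ![F, G] := by
    refine AlgebraicIndependent.of_comp (Polynomial.aeval z) ?_
    convert h using 1
    ext i
    fin_cases i <;> rfl
  have := h'.lift_cardinalMk_le_trdeg
  rw [Polynomial.trdeg_of_isDomain] at this
  simp at this

/-! ### Fractions in a generator -/

open IntermediateField in
/-- Every element of `K(w)` is a quotient of coprime polynomials in `w`. -/
theorem IntermediateField.exists_isCoprime_of_mem_adjoin_simple {K F : Type*} [Field K] [Field F]
    [Algebra K F] {w x : F} (hx : x ∈ K⟮w⟯) :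
    ∃ P Q : Polynomial K, IsCoprime P Q ∧ Polynomial.aeval w Q ≠ 0 ∧
      x = Polynomial.aeval w P / Polynomial.aeval w Q := by
  classical
  obtain ⟨P, Q, rfl⟩ := (mem_adjoin_simple_iff K x).1 hx
  by_cases hQ : Polynomial.aeval w Q = 0
  -- Division by zero makes the element `0`, which is `0 / 1`.
  · exact ⟨0, 1, isCoprime_one_right, by simp, by simp [hQ]⟩
  have hQ0 : Q ≠ 0 := by rintro rfl; simp at hQ
  obtain ⟨P', hP⟩ := EuclideanDomain.gcd_dvd_left P Q
  obtain ⟨Q', hQ'⟩ := EuclideanDomain.gcd_dvd_right P Q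
  have hG : EuclideanDomain.gcd P Q ≠ 0 := by
    intro h
    rw [h, zero_mul] at hQ'
    exact hQ0 hQ'
  refine ⟨P', Q', ⟨EuclideanDomain.gcdA P Q, EuclideanDomain.gcdB P Q, ?_⟩, ?_, ?_⟩
  · refine mul_left_cancel₀ hG ?_
    linear_combination -EuclideanDomain.gcd_eq_gcd_ab P Q - EuclideanDomain.gcdA P Q * hP -
      EuclideanDomain.gcdB P Q * hQ'
  · intro h
    rw [hQ', map_mul, h, mul_zero] at hQ
    exact hQ rfl
  · have hGw : Polynomial.aeval w (EuclideanDomain.gcd P Q) ≠ 0 := by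
      intro h
      rw [hQ', map_mul, h, zero_mul] at hQ
      exact hQ rfl
    rw [← mul_div_mul_left (Polynomial.aeval w P') _ hGw, ← map_mul, ← map_mul, ← hP, ← hQ']

open IntermediateField in
/-- A generator `w` of a field in which a nonconstant `x` is a fraction of degree at most one lies
in `K(x)`. -/
theorem IntermediateField.mem_adjoin_simple_of_natDegree_le_one {K F : Type*} [Field K] [Field F]
    [Algebra K F] {w x : F} (hx : x ∉ Set.range (algebraMap K F)) {P Q : Polynomial K}
    (hP : P.natDegree ≤ 1) (hQ : Q.natDegree ≤ 1) (hQw : Polynomial.aeval w Q ≠ 0)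
    (hxPQ : x = Polynomial.aeval w P / Polynomial.aeval w Q) : w ∈ K⟮x⟯ := by
  obtain ⟨a, b, rfl⟩ := Polynomial.exists_eq_X_add_C_of_natDegree_le_one hP
  obtain ⟨c, e, rfl⟩ := Polynomial.exists_eq_X_add_C_of_natDegree_le_one hQ
  rw [eq_div_iff hQw] at hxPQ
  simp only [map_add, map_mul, Polynomial.aeval_C, Polynomial.aeval_X] at hxPQ hQw
  -- If this denominator of the inverse Möbius map vanished, `x` would be the constant `a / c`, or
  -- `b / e` when `c = 0`.
  have h0 : x * algebraMap K F c - algebraMap K F a ≠ 0 := by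
    intro h
    have hc : c = 0 := by
      by_contra hc
      have hc' : algebraMap K F c ≠ 0 := by simpa using hc
      exact hx ⟨a / c, by rw [map_div₀, div_eq_iff hc']; linear_combination -h⟩
    subst hc
    have ha : algebraMap K F a = 0 := by simpa using h
    rw [ha] at hxPQ
    simp only [map_zero, zero_mul, zero_add] at hxPQ hQw
    exact hx ⟨b / e, by rw [map_div₀, div_eq_iff hQw, hxPQ]⟩
  have hw : w = (algebraMap K F b - x * algebraMap K F e) /
      (x * algebraMap K F c - algebraMap K F a) := by
    rw [eq_div_iff h0]
    linear_combination hxPQ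
  have hxm := mem_adjoin_simple_self K x
  rw [hw]
  exact div_mem (sub_mem (algebraMap_mem _ _) (mul_mem hxm (algebraMap_mem _ _)))
    (sub_mem (mul_mem hxm (algebraMap_mem _ _)) (algebraMap_mem _ _))

theorem MvPolynomial.div_notMem_range_of_algebraicIndependent {n : ℕ} {K : Type*} [Field K]
    {f g : MvPolynomial (Fin n) K} (hind : AlgebraicIndependent K ![f, g]) :
    algebraMap (MvPolynomial (Fin n) K) (MvRatFunc n K) f /
      algebraMap (MvPolynomial (Fin n) K) (MvRatFunc n K) g ∉
        Set.range (algebraMap K (MvRatFunc n K)) := by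
  have hg : g ≠ 0 := by simpa using hind.ne_zero 1
  have hgF : algebraMap _ (MvRatFunc n K) g ≠ 0 := by simpa using hg
  rintro ⟨c, hc⟩
  rw [eq_div_iff hgF, IsScalarTower.algebraMap_apply K (MvPolynomial (Fin n) K), ← map_mul] at hc
  have hf := IsFractionRing.injective (MvPolynomial (Fin n) K) (MvRatFunc n K) hc
  refine not_algebraicIndependent_of_mem_adjoin_singleton (z := g) ?_
    (Algebra.self_mem_adjoin_singleton K g) hind
  rw [← hf]
  exact mul_mem (Subalgebra.algebraMap_mem _ c) (Algebra.self_mem_adjoin_singleton K g)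

/-! ### Degree bound and conclusion -/

open IntermediateField in
/-- If a quotient `f / g` of algebraically independent coprime polynomials, one of which is
irreducible, is a fraction in `w`, then this fraction has degree at most one. -/
theorem MvPolynomial.natDegree_le_one_of_div_eq {n : ℕ} {K : Type*} [Field K] [IsAlgClosed K]
    {f g : MvPolynomial (Fin n) K} (hcop : IsRelPrime f g)
    (hind : AlgebraicIndependent K ![f, g]) (hirr : Irreducible f ∨ Irreducible g)
    {w : MvRatFunc n K} {P Q : Polynomial K} (hPQ : IsCoprime P Q)
    (hQw : Polynomial.aeval w Q ≠ 0)
    (h : algebraMap (MvPolynomial (Fin n) K) (MvRatFunc n K) f /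
      algebraMap (MvPolynomial (Fin n) K) (MvRatFunc n K) g =
        Polynomial.aeval w P / Polynomial.aeval w Q) :
    max P.natDegree Q.natDegree ≤ 1 := by
  obtain ⟨p, q, hpq, hqF, hw⟩ : ∃ p q : MvPolynomial (Fin n) K, IsRelPrime p q ∧
      algebraMap _ (MvRatFunc n K) q ≠ 0 ∧
      algebraMap _ (MvRatFunc n K) p / algebraMap _ _ q = w :=
    ⟨IsFractionRing.num (MvPolynomial (Fin n) K) w, IsFractionRing.den (MvPolynomial (Fin n) K) w,
      IsFractionRing.num_den_reduced (MvPolynomial (Fin n) K) w, by simp,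
      IsFractionRing.mk'_num_den' (MvPolynomial (Fin n) K) w⟩
  have hf : f ≠ 0 := by simpa using hind.ne_zero 0
  have hg : g ≠ 0 := by simpa using hind.ne_zero 1
  have hgF : algebraMap _ (MvRatFunc n K) g ≠ 0 := by simpa using hg
  have hfF : algebraMap _ (MvRatFunc n K) f ≠ 0 := by simpa using hf
  have hQ0 : Q ≠ 0 := by rintro rfl; simp at hQw
  have hP0 : P ≠ 0 := by
    rintro rfl
    rw [map_zero, zero_div] at h
    exact div_ne_zero hfF hgF h
  set d := max P.natDegree Q.natDegree with hd
  have hN := Polynomial.algebraMap_homogFactors_prod (F := MvRatFunc n K)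
    (le_max_left _ _ : _ ≤ d) p hqF
  have hM := Polynomial.algebraMap_homogFactors_prod (F := MvRatFunc n K)
    (le_max_right _ _ : _ ≤ d) p hqF
  have hNM : IsRelPrime (P.homogFactors d p q).prod (Q.homogFactors d p q).prod :=
    Polynomial.isRelPrime_homogFactors_prod hPQ hpq
  have hcardN := Polynomial.card_homogFactors (le_max_left _ _ : P.natDegree ≤ d) p q
  have hcardM := Polynomial.card_homogFactors (le_max_right _ _ : Q.natDegree ≤ d) p q
  set N := (P.homogFactors d p q).prod with hNdef
  set M := (Q.homogFactors d p q).prod with hMdef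
  rw [hw] at hN hM
  have huP : IsUnit (algebraMap K (MvPolynomial (Fin n) K) P.leadingCoeff) :=
    (Polynomial.leadingCoeff_ne_zero.2 hP0).isUnit.map _
  have huQ : IsUnit (algebraMap K (MvPolynomial (Fin n) K) Q.leadingCoeff) :=
    (Polynomial.leadingCoeff_ne_zero.2 hQ0).isUnit.map _
  -- `φ = P(w)/Q(w)` with both sides scaled by `q ^ d`; the leading coefficients are restored
  -- because `N` and `M` omit them.
  have hmul : algebraMap K (MvPolynomial (Fin n) K) Q.leadingCoeff * f * M =
      algebraMap K (MvPolynomial (Fin n) K) P.leadingCoeff * g * N := by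
    apply IsFractionRing.injective (MvPolynomial (Fin n) K) (MvRatFunc n K)
    simp only [map_mul, ← IsScalarTower.algebraMap_apply]
    rw [div_eq_div_iff hgF hQw] at h
    linear_combination (algebraMap _ (MvRatFunc n K) f) * hM - (algebraMap _ (MvRatFunc n K) g) * hN
      + (algebraMap _ (MvRatFunc n K) q) ^ d * h
  obtain ⟨hfN, hgM⟩ := IsRelPrime.associated_of_mul_eq_mul
    ((isRelPrime_mul_unit_left_left huQ).2 ((isRelPrime_mul_unit_left_right huP).2 hcop))
    hNM hmul
  have hfN : Associated f N := (associated_unit_mul_left f _ huQ).symm.trans hfN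
  have hgM : Associated g M := (associated_unit_mul_left g _ huP).symm.trans hgM
  by_contra! hd2
  obtain ⟨z, hpz, hqz⟩ : ∃ z : MvPolynomial (Fin n) K,
      p ∈ Algebra.adjoin K {z} ∧ q ∈ Algebra.adjoin K {z} := by
    have key : ∀ {S : Polynomial K}, Irreducible (S.homogFactors d p q).prod →
        (S.homogFactors d p q).card = d →
        ∃ z : MvPolynomial (Fin n) K, p ∈ Algebra.adjoin K {z} ∧ q ∈ Algebra.adjoin K {z} := by
      intro S hS hcard
      obtain ⟨x, hx, hxu⟩ := Multiset.exists_isUnit_of_irreducible_prod hS (by lia)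
      -- Units of the polynomial ring are constants, so some `p - a q`, or `q` itself, is constant.
      obtain ⟨c, -, rfl⟩ := MvPolynomial.isUnit_iff_eq_C_of_isReduced.1 hxu
      exact Polynomial.exists_mem_adjoin_of_mem_homogFactors hx
    rcases hirr with hirr | hirr
    · exact key (hfN.irreducible hirr) hcardN
    · exact key (hgM.irreducible hirr) hcardM
  have mem_of_associated : ∀ {a b : MvPolynomial (Fin n) K}, Associated a b →
      b ∈ Algebra.adjoin K {z} → a ∈ Algebra.adjoin K {z} := by
    rintro a b hab hb
    obtain ⟨u, rfl⟩ := hab.symm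
    obtain ⟨c, -, hc⟩ := MvPolynomial.isUnit_iff_eq_C_of_isReduced.1 u.isUnit
    rw [hc]
    exact mul_mem hb (Subalgebra.algebraMap_mem _ c)
  exact not_algebraicIndependent_of_mem_adjoin_singleton
    (mem_of_associated hfN (Polynomial.homogFactors_prod_mem hpz hqz))
    (mem_of_associated hgM (Polynomial.homogFactors_prod_mem hpz hqz)) hind

theorem theorem1 {K : Type*} [Field K] [IsAlgClosed K] [CharZero K] (n : ℕ)
    (f g : MvPolynomial (Fin n) K) (hcop : IsRelPrime f g)
    (hind : AlgebraicIndependent K ![f, g]) (hirr : Irreducible f ∨ Irreducible g) :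
    IsClosedRational (algebraMap (MvPolynomial (Fin n) K) (MvRatFunc n K) f /
      algebraMap (MvPolynomial (Fin n) K) (MvRatFunc n K) g) := by
  have hφ := MvPolynomial.div_notMem_range_of_algebraicIndependent hind
  refine ⟨hφ, fun ψ hψ => ?_⟩
  obtain ⟨w, hφw, hψw⟩ := MvRatFunc.exists_mem_adjoin_simple hφ hψ
  obtain ⟨P, Q, hPQ, hQw, h⟩ := IntermediateField.exists_isCoprime_of_mem_adjoin_simple hφw
  have hdeg := MvPolynomial.natDegree_le_one_of_div_eq hcop hind hirr hPQ hQw h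
  have hw := IntermediateField.mem_adjoin_simple_of_natDegree_le_one hφ
    ((le_max_left _ _).trans hdeg) ((le_max_right _ _).trans hdeg) hQw h
  exact IntermediateField.adjoin_simple_le_iff.2 hw hψw
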